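/- Let $v:\mathbb{R}/\mathbb{Z}\to\mathbb{R}$ be $C^1$ on $(0,1)$, with $\|v\|_{C^1}=\sup_{(0,1)}|v|+\sup_{(0,1)}|v'|<\infty$ and $\inf_{x\in(0,1)}|v'(x)|>0$. Let $T(x)=2x$ be the doubling map of $\mathbb{R}/\mathbb{Z}$. For $\lambda>0$ and $E\in\mathbb{R}$ put $$A(x)=\begin{pmatrix}E-\lambda v(x)&-1\\1&0\end{pmatrix},\qquad A_n(x)=A(T^{n-1}x)\cdots A(Tx)A(x)\ (n\ge 1),\qquad A_0(x)=I_2 .$$ Then each $\log\|A_n\|$ (operator norm for the Euclidean norm on $\mathbb{R}^2$) is integrable, and the Lyapunov exponent $$L(E;\lambda)=\lim_{n\to\infty}\frac1n\int_{\mathbb{R}/\mathbb{Z}}\log\|A_n(x)\|\,dx$$ exists as a finite limit. Moreover, there is a constant $C_0=C_0(v)>0$ such that $$L(E;\lambda)>\log\lambda-C_0\qquad\text{for all }\lambda>0\text{ and all }E\in\mathbb{R}.$$ In particular, the exponent is uniformly positive in $E$ at large coupling: there are $\lambda_0=\lambda_0(v)>1$ and $c>0$ such that $\inf_{E\in\mathbb{R}}L(E;\lambda)\ge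 c\log\lambda$ for every $\lambda\ge\lambda_0$. -/

import Mathlib

open MeasureTheory Filter Topology

namespace DoublingMap

/-- The standing assumptions on a potential `v : ℝ/ℤ → ℝ`: read on the fundamental domain
`(0,1)`, `v` is `C¹`, its `C¹` norm is finite, and `|v'|` is bounded away from zero.
The value of `v` at the single point `0 ∈ ℝ/ℤ` is unrestricted. -/
structure IsAdmissible (v : UnitAddCircle → ℝ) : Prop where
  contDiffOn : ContDiffOn ℝ 1 (fun x : ℝ => v (x : UnitAddCircle)) (Set.Ioo 0 1)
  bounded : ∃ C : ℝ, ∀ x ∈ Set.Ioo (0 : ℝ) 1,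
    |v (x : UnitAddCircle)| + |deriv (fun y : ℝ => v (y : UnitAddCircle)) x| ≤ C
  deriv_bound : ∃ c : ℝ, 0 < c ∧ ∀ x ∈ Set.Ioo (0 : ℝ) 1,
    c ≤ |deriv (fun y : ℝ => v (y : UnitAddCircle)) x|

/-- The doubling map `T x = 2x` on `ℝ/ℤ`. -/
def doubling (x : UnitAddCircle) : UnitAddCircle := (2 : ℕ) • x

/-- The Schrödinger cocycle map `A^{(E - lam v)}`. -/
def cocycleMap (v : UnitAddCircle → ℝ) (lam E : ℝ) (x : UnitAddCircle) :
    Matrix (Fin 2) (Fin 2) ℝ :=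
  !![E - lam * v x, -1; 1, 0]

/-- The iterates `A_n(x) = A(T^{n-1} x) ⋯ A(T x) A(x)`, with `A_0(x) = 1`. -/
def cocycleIter (v : UnitAddCircle → ℝ) (lam E : ℝ) :
    ℕ → UnitAddCircle → Matrix (Fin 2) (Fin 2) ℝ
  | 0, _ => 1
  | n + 1, x => cocycleMap v lam E (doubling^[n] x) * cocycleIter v lam E n x

/-- `log ‖A_n(x)‖`, with the operator norm on the Euclidean plane. -/
noncomputable def logNorm (v : UnitAddCircle → ℝ) (lam E : ℝ) (n : ℕ) (x : UnitAddCircle) : ℝ :=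
  Real.log ‖Matrix.toEuclideanCLM (𝕜 := ℝ) (cocycleIter v lam E n x)‖

/-- The averages `(1/n) ∫ log ‖A_n(x)‖ dx` over `ℝ/ℤ` with its Lebesgue probability measure. -/
noncomputable def meanLogNorm (v : UnitAddCircle → ℝ) (lam E : ℝ) (n : ℕ) : ℝ :=
  (1 / (n : ℝ)) * ∫ x : UnitAddCircle, logNorm v lam E n x

/-- The Lyapunov exponent `L(E; lam) = lim_n (1/n) ∫ log ‖A_n(x)‖ dx`. -/
noncomputable def lyapunovExponent (v : UnitAddCircle → ℝ) (E lam : ℝ) : ℝ :=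
  limUnder atTop (fun n : ℕ => meanLogNorm v lam E n)

end DoublingMap

/-! The top-left entry u_n of A_n is bounded by the norm of A_n, and log |u_n| is the telescoping
sum of log |r_k|, k < n, with r_k = u_{k+1}/u_k. So it is enough to bound the mean of log |r_k|
below by log λ minus a constant, uniformly in k and E.

Since v' keeps one sign and stays at least c in size, the Wronskian of u_{k+1} and u_k accumulates
terms of one sign (`wave_wronskian_bound`). Hence r_k is monotone with slope at least cλ2^k in size,
away from the zeros of u_k and the discontinuities created by the doubling. Monotonicity allows at
most one zero of u_{k+1} per branch, so by induction there are at most 2^(k+1) branches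
(`exists_breakpoints`). The exponentials cancel: {|r_k| < s} has measure at most 4s/(cλ)
(`volume_abs_ratio_lt_le`), and a layer-cake integration costs only 1 per step
(`integral_log_wave_ge`).

The limit itself exists by subadditivity, as doubling preserves Lebesgue measure. -/

namespace DoublingMap

/-! ### Functions growing off a finite set, and their sublevel sets -/

/-- `f` grows with slope at least `κ` on every compact interval of `(0,1)` avoiding `S`. -/
def GrowsOffSet (S : Finset ℝ) (κ : ℝ) (f : ℝ → ℝ) : Prop :=
  ∀ x y : ℝ, 0 < x → x ≤ y → y < 1 → (∀ z ∈ Set.Icc x y, z ∉ S) → κ * (y - x) ≤ f y - f x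

/-- The index of the gap of `S` containing a given point. -/
noncomputable def gapIndex (S : Finset ℝ) (x : ℝ) : ℕ := (S.filter (· < x)).card

lemma gapIndex_lt (S : Finset ℝ) (x : ℝ) : gapIndex S x < S.card + 1 :=
  Nat.lt_succ_of_le (Finset.card_filter_le _ _)

lemma Icc_disjoint_of_gapIndex_eq {S : Finset ℝ} {x y : ℝ} (hxy : x ≤ y)
    (hy : y ∉ S) (h : gapIndex S x = gapIndex S y) : ∀ z ∈ Set.Icc x y, z ∉ S := by
  intro z hz hzS
  have hsub : S.filter (· < x) ⊆ S.filter (· < y) := fun w hw => by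
    simp only [Finset.mem_filter] at hw ⊢
    exact ⟨hw.1, hw.2.trans_le hxy⟩
  have heq := Finset.eq_of_subset_of_card_le hsub h.ge
  have hzy : z < y := lt_of_le_of_ne hz.2 fun e => hy (e ▸ hzS)
  have : z ∈ S.filter (· < x) := heq ▸ Finset.mem_filter.2 ⟨hzS, hzy⟩
  exact absurd (Finset.mem_filter.1 this).2 (not_lt.2 hz.1)

lemma GrowsOffSet.dist_le {S : Finset ℝ} {κ : ℝ} {f : ℝ → ℝ}
    (hf : GrowsOffSet S κ f) {x y : ℝ} (hx : x ∈ Set.Ioo (0 : ℝ) 1) (hy : y ∈ Set.Ioo (0 : ℝ) 1)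
    (hxS : x ∉ S) (hyS : y ∉ S) (h : gapIndex S x = gapIndex S y) :
    κ * |x - y| ≤ |f x - f y| := by
  rcases le_total x y with hxy | hxy
  · have := hf x y hx.1 hxy hy.2 (Icc_disjoint_of_gapIndex_eq hxy hyS h)
    rw [abs_sub_comm x y, abs_sub_comm (f x), abs_of_nonneg (sub_nonneg.2 hxy)]
    exact this.trans (le_abs_self _)
  · have := hf y x hy.1 hxy hx.2 (Icc_disjoint_of_gapIndex_eq hxy hxS h.symm)
    rw [abs_of_nonneg (sub_nonneg.2 hxy)]
    exact this.trans (le_abs_self _)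

/-- Strict growth allows one zero per gap, so `gapIndex` is injective on the zeros off `S`. -/
lemma GrowsOffSet.exists_zeros {S : Finset ℝ} {κ : ℝ} {f : ℝ → ℝ} (hκ : 0 < κ)
    (hf : GrowsOffSet S κ f) :
    ∃ Z : Finset ℝ, Z.card ≤ S.card + 1 ∧
      ∀ x ∈ Set.Ioo (0 : ℝ) 1, x ∉ S → f x = 0 → x ∈ Z := by
  set A : Set ℝ := {x | x ∈ Set.Ioo (0 : ℝ) 1 ∧ x ∉ S ∧ f x = 0}
  have hmaps : Set.MapsTo (gapIndex S) A (Finset.range (S.card + 1) : Set ℕ) := fun x _ => by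
    simpa using gapIndex_lt S x
  have hinj : Set.InjOn (gapIndex S) A := fun x hx y hy h => by
    have := hf.dist_le hx.1 hy.1 hx.2.1 hy.2.1 h
    rw [hx.2.2, hy.2.2, sub_zero, abs_zero] at this
    have h0 : |x - y| ≤ 0 := by
      by_contra! h'
      exact absurd this (not_le.2 (mul_pos hκ h'))
    exact sub_eq_zero.1 (abs_nonpos_iff.1 h0)
  have hfin : A.Finite := Set.Finite.of_injOn hmaps hinj (Finset.finite_toSet _)
  refine ⟨hfin.toFinset, ?_, fun x h1 h2 h3 => hfin.mem_toFinset.2 ⟨h1, h2, h3⟩⟩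
  calc hfin.toFinset.card ≤ (Finset.range (S.card + 1)).card :=
        Finset.card_le_card_of_injOn (gapIndex S) (by simpa using hmaps) (by simpa using hinj)
    _ = _ := Finset.card_range _

/-- In each gap the sublevel set has diameter at most 2s/κ; the points of `S` are null. -/
lemma GrowsOffSet.volume_abs_lt_le {S : Finset ℝ} {κ : ℝ} {f : ℝ → ℝ} (hκ : 0 < κ)
    (hf : GrowsOffSet S κ f) (s : ℝ) :
    volume {x | x ∈ Set.Ioo (0 : ℝ) 1 ∧ |f x| < s} ≤
      ENNReal.ofReal ((S.card + 1 : ℝ) * (2 * s / κ)) := by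
  have hcover : {x | x ∈ Set.Ioo (0 : ℝ) 1 ∧ |f x| < s} ⊆ (S : Set ℝ) ∪
      ⋃ k ∈ Finset.range (S.card + 1),
        {x | x ∈ Set.Ioo (0 : ℝ) 1 ∧ x ∉ S ∧ |f x| < s ∧ gapIndex S x = k} := by
    intro x hx
    by_cases hxS : x ∈ S
    · exact Or.inl hxS
    · refine Or.inr (Set.mem_iUnion₂.2 ⟨gapIndex S x, ?_, hx.1, hxS, hx.2, rfl⟩)
      simpa using gapIndex_lt S x
  refine (measure_mono hcover).trans ((measure_union_le _ _).trans ?_)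
  rw [S.finite_toSet.measure_zero, zero_add]
  refine (measure_biUnion_finset_le _ _).trans ?_
  refine (Finset.sum_le_card_nsmul _ _ (ENNReal.ofReal (2 * s / κ)) fun k _ => ?_).trans ?_
  · refine (Real.volume_le_diam _).trans (Metric.ediam_le fun x hx y hy => ?_)
    rw [edist_dist, Real.dist_eq]
    refine ENNReal.ofReal_le_ofReal ((le_div_iff₀ hκ).2 ?_)
    have h1 := hf.dist_le hx.1 hy.1 hx.2.1 hy.2.1 (hx.2.2.2.trans hy.2.2.2.symm)
    have h2 : |f x - f y| ≤ |f x| + |f y| := abs_sub _ _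
    have h3 := hx.2.2.1
    have h4 := hy.2.2.1
    linarith
  · rw [Finset.card_range, nsmul_eq_mul, ENNReal.ofReal_mul (by positivity)]
    gcongr
    rw [← Nat.cast_succ, ENNReal.ofReal_natCast]

/-- Layer cake: the hypothesis with s = e^(-t)/K bounds the tail at height t by e^(-t), whose
integral is 1. -/
lemma lintegral_neg_log_le_one {α : Type*} [MeasurableSpace α] {μ : Measure α} {f : α → ℝ}
    (hf : AEMeasurable f μ) {K : ℝ} (hK : 0 < K)
    (h : ∀ s : ℝ, 0 < s → μ {x | |f x| < s} ≤ ENNReal.ofReal (K * s)) :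
    ∫⁻ x, ENNReal.ofReal (max (-Real.log (K * |f x|)) 0) ∂μ ≤ 1 := by
  have hm : AEMeasurable (fun x => max (-Real.log (K * |f x|)) 0) μ :=
    ((Real.measurable_log.comp_aemeasurable
      ((continuous_abs.measurable.comp_aemeasurable hf).const_mul K)).neg).max aemeasurable_const
  rw [lintegral_eq_lintegral_meas_lt (f := fun x => max (-Real.log (K * |f x|)) 0) μ
    (.of_forall fun x => le_max_right _ _) hm]
  calc ∫⁻ t in Set.Ioi (0 : ℝ), μ {a | t < max (-Real.log (K * |f a|)) 0}
      ≤ ∫⁻ t in Set.Ioi (0 : ℝ), ENNReal.ofReal (Real.exp (-t)) := by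
        refine setLIntegral_mono (by fun_prop) fun t ht => ?_
        have ht : 0 < t := ht
        refine (measure_mono fun x hx => ?_).trans
          ((h (Real.exp (-t) / K) (by positivity)).trans_eq (by rw [mul_div_cancel₀ _ hK.ne']))
        have hx1 : t < -Real.log (K * |f x|) := by
          rcases lt_max_iff.1 (Set.mem_ofPred_eq ▸ hx) with h1 | h1
          · exact h1
          · exact absurd h1 ht.not_gt
        have hpos : 0 < K * |f x| := by
          refine lt_of_le_of_ne (by positivity) fun e => ?_
          rw [← e, Real.log_zero] at hx1
          linarith
        have h2 : K * |f x| < Real.exp (-t) := (Real.log_lt_iff_lt_exp hpos).1 (by linarith)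
        exact (lt_div_iff₀' hK).2 h2
    _ = ENNReal.ofReal (∫ t in Set.Ioi (0 : ℝ), Real.exp (-t)) :=
        (ofReal_integral_eq_lintegral_ofReal (integrableOn_exp_neg_Ioi 0)
          (.of_forall fun t => (Real.exp_pos _).le)).symm
    _ = 1 := by rw [integral_exp_neg_Ioi_zero, ENNReal.ofReal_one]

/-! ### The scalar recursion and its ratios -/

/-- The solution of the Schrödinger equation `u (n+1) + u (n-1) = (E - lam w (2 ^ n x)) u n`
over the real line with initial data `u 0 = 1`, `u (-1) = 0`. -/
def wave (w : ℝ → ℝ) (lam E : ℝ) : ℕ → ℝ → ℝ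
  | 0, _ => 1
  | 1, x => E - lam * w x
  | n + 2, x => (E - lam * w (2 ^ (n + 1) * x)) * wave w lam E (n + 1) x - wave w lam E n x

/-- `x` is not an integer. -/
def NonInt (x : ℝ) : Prop := ∀ k : ℤ, (k : ℝ) ≠ x

lemma NonInt.of_pow_succ {n : ℕ} {x : ℝ} (h : NonInt (2 ^ (n + 1) * x)) : NonInt (2 ^ n * x) :=
  fun k hk => h (2 * k) (by push_cast; rw [hk]; ring)

lemma wave_ne_zero_of_succ_eq_zero (w : ℝ → ℝ) (lam E : ℝ) {n : ℕ} {x : ℝ}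
    (h : wave w lam E (n + 1) x = 0) : wave w lam E n x ≠ 0 := by
  induction n with
  | zero => simp [wave]
  | succ n ih =>
    intro h0
    refine ih h0 ?_
    rw [wave, h0] at h
    linarith

section Monotone

variable {w : ℝ → ℝ} {lam E c σ : ℝ}

/-- With W_n = u_{n+1}' u_n - u_{n+1} u_n', the recursion gives W_{n+1} = W_n - λ 2^(n+1) w'(2^(n+1)
x) u_{n+1}^2. The sign σ makes all increments of σW_n nonnegative. -/
lemma wave_wronskian_bound (hlam : 0 < lam) (hc : 0 ≤ c)
    (hd : ∀ x, NonInt x → DifferentiableAt ℝ w x) (hσ : ∀ x, NonInt x → c ≤ -(σ * deriv w x))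
    (n : ℕ) {x : ℝ} (hx : NonInt (2 ^ n * x)) :
    DifferentiableAt ℝ (wave w lam E (n + 1)) x ∧ DifferentiableAt ℝ (wave w lam E n) x ∧
      c * lam * 2 ^ n * wave w lam E n x ^ 2 ≤
        σ * (deriv (wave w lam E (n + 1)) x * wave w lam E n x -
          wave w lam E (n + 1) x * deriv (wave w lam E n) x) := by
  induction n with
  | zero =>
    have hx' : NonInt x := by simpa using hx
    have h0 : wave w lam E 0 = fun _ => 1 := by funext y; simp [wave]
    have h1 : wave w lam E (0 + 1) = fun y => E - lam * w y := by funext y; simp [wave]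
    have hd1 : HasDerivAt (fun y => E - lam * w y) (-(lam * deriv w x)) x :=
      ((hd x hx').hasDerivAt.const_mul lam).const_sub E
    rw [h0, h1]
    refine ⟨hd1.differentiableAt, differentiableAt_const _, ?_⟩
    rw [hd1.deriv, deriv_const]
    have := mul_le_mul_of_nonneg_right (hσ x hx') hlam.le
    simp only [pow_zero, mul_one, one_pow, mul_zero, sub_zero]
    linarith
  | succ n ih =>
    obtain ⟨i1, i2, i3⟩ := ih hx.of_pow_succ
    have h2 : wave w lam E (n + 1 + 1) = fun y =>
        (E - lam * w (2 ^ (n + 1) * y)) * wave w lam E (n + 1) y - wave w lam E n y := by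
      funext y; simp [wave]
    have hlin : HasDerivAt (fun y : ℝ => (2 : ℝ) ^ (n + 1) * y) (2 ^ (n + 1)) x := by
      simpa using (hasDerivAt_id x).const_mul ((2 : ℝ) ^ (n + 1))
    have hw : HasDerivAt (fun y => w (2 ^ (n + 1) * y))
        (deriv w (2 ^ (n + 1) * x) * 2 ^ (n + 1)) x :=
      HasDerivAt.comp x (hd _ hx).hasDerivAt hlin
    have hd2 := (((hw.const_mul lam).const_sub E).mul i1.hasDerivAt).sub i2.hasDerivAt
    have hd2' := hd2.congr_of_eventuallyEq (.of_eq h2)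
    refine ⟨hd2'.differentiableAt, i1, ?_⟩
    rw [hd2'.deriv, h2]
    beta_reduce
    have hk := mul_le_mul_of_nonneg_right (hσ _ hx)
      (by positivity : 0 ≤ lam * 2 ^ (n + 1) * wave w lam E (n + 1) x ^ 2)
    -- Only the newest increment is kept: σW_n is nonnegative and can be dropped.
    have hp : 0 ≤ c * lam * 2 ^ n * wave w lam E n x ^ 2 := by positivity
    generalize deriv (wave w lam E (n + 1)) x = p1 at *
    generalize deriv (wave w lam E n) x = p0 at *
    generalize wave w lam E (n + 1) x = q1 at *
    generalize wave w lam E n x = q0 at *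
    generalize deriv w (2 ^ (n + 1) * x) = d at *
    linear_combination hk + i3 + hp

lemma wave_ratio_growsOffSet (hlam : 0 < lam) (hc : 0 ≤ c)
    (hd : ∀ x, NonInt x → DifferentiableAt ℝ w x) (hσ : ∀ x, NonInt x → c ≤ -(σ * deriv w x))
    {n : ℕ} {S : Finset ℝ}
    (hS : ∀ x ∈ Set.Ioo (0 : ℝ) 1, x ∉ S → NonInt (2 ^ n * x) ∧ wave w lam E n x ≠ 0) :
    GrowsOffSet S (c * lam * 2 ^ n) (fun x => σ * (wave w lam E (n + 1) x / wave w lam E n x)) := by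
  intro x y hx hxy hy hz
  have hder : ∀ z ∈ Set.Icc x y, ∃ d, c * lam * 2 ^ n ≤ d ∧
      HasDerivAt (fun x => σ * (wave w lam E (n + 1) x / wave w lam E n x)) d z := by
    intro z hzI
    obtain ⟨h1, h2⟩ := hS z ⟨hx.trans_le hzI.1, hzI.2.trans_lt hy⟩ (hz z hzI)
    obtain ⟨i1, i2, i3⟩ := wave_wronskian_bound (E := E) hlam hc hd hσ n h1
    refine ⟨_, ?_, (i1.hasDerivAt.div i2.hasDerivAt h2).const_mul σ⟩
    rw [← mul_div_assoc, le_div_iff₀ (by positivity)]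
    exact i3
  have hdiff : DifferentiableOn ℝ (fun x => σ * (wave w lam E (n + 1) x / wave w lam E n x))
      (Set.Icc x y) := fun z hzI => by
    obtain ⟨d, -, hd⟩ := hder z hzI
    exact hd.differentiableAt.differentiableWithinAt
  refine (convex_Icc x y).mul_sub_le_image_sub_of_le_deriv hdiff.continuousOn
    (hdiff.mono interior_subset) (fun z hzI => ?_) x (Set.left_mem_Icc.2 hxy) y
    (Set.right_mem_Icc.2 hxy) hxy
  obtain ⟨d, h1, h2⟩ := hder z (interior_subset hzI)
  rwa [h2.deriv]

lemma exists_dyadic_finset (n : ℕ) : ∃ D : Finset ℝ, D.card + 1 ≤ 2 ^ n ∧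
    (∀ x ∈ Set.Ioo (0 : ℝ) 1, ¬ NonInt (2 ^ n * x) → x ∈ D) ∧
    ∀ x ∈ D, ¬ NonInt (2 ^ n * x) := by
  refine ⟨(Finset.Ioo (0 : ℤ) (2 ^ n)).image fun k : ℤ => (k : ℝ) / 2 ^ n, ?_, ?_, ?_⟩
  · have h1 := Finset.card_image_le (s := Finset.Ioo (0 : ℤ) (2 ^ n))
      (f := fun k : ℤ => (k : ℝ) / 2 ^ n)
    have h2 : (Finset.Ioo (0 : ℤ) (2 ^ n)).card = 2 ^ n - 1 := by
      rw [Int.card_Ioo]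
      have : ((2 : ℤ) ^ n) = ((2 ^ n : ℕ) : ℤ) := by push_cast; rfl
      omega
    have h3 : 0 < 2 ^ n := by positivity
    omega
  · intro x hx hn
    simp only [NonInt, not_forall, not_not] at hn
    obtain ⟨k, hk⟩ := hn
    have hp : (0 : ℝ) < 2 ^ n := by positivity
    refine Finset.mem_image.2 ⟨k, Finset.mem_Ioo.2 ⟨?_, ?_⟩, ?_⟩
    · have : (0 : ℝ) < k := hk ▸ mul_pos hp hx.1
      exact_mod_cast this
    · have : (k : ℝ) < 2 ^ n := hk ▸ mul_lt_of_lt_one_right hp hx.2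
      exact_mod_cast this
    · rw [hk]; field_simp
  · intro x hx
    obtain ⟨k, -, rfl⟩ := Finset.mem_image.1 hx
    exact fun h => h k (by field_simp)

lemma exists_breakpoints (hlam : 0 < lam) (hc : 0 < c)
    (hd : ∀ x, NonInt x → DifferentiableAt ℝ w x) (hσ : ∀ x, NonInt x → c ≤ -(σ * deriv w x))
    (n : ℕ) : ∃ S : Finset ℝ, S.card + 1 ≤ 2 ^ (n + 1) ∧
      (∀ x ∈ Set.Ioo (0 : ℝ) 1, x ∉ S → NonInt (2 ^ n * x) ∧ wave w lam E n x ≠ 0) ∧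
      ∀ x ∈ S, ¬ NonInt (2 ^ n * x) ∨ wave w lam E n x = 0 := by
  induction n with
  | zero =>
    refine ⟨∅, by simp, fun x hx _ => ⟨?_, by simp [wave]⟩, by simp⟩
    intro k hk
    rw [pow_zero, one_mul] at hk
    have h1 : (0 : ℝ) < k := hk ▸ hx.1
    have h2 : (k : ℝ) < 1 := hk ▸ hx.2
    norm_cast at h1 h2
    omega
  | succ n ih =>
    obtain ⟨S, hcard, hS, hS'⟩ := ih
    obtain ⟨Z, hZcard, hZ⟩ := (wave_ratio_growsOffSet hlam hc.le hd hσ hS).exists_zeros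
      (by positivity)
    obtain ⟨D, hDcard, hD, hD'⟩ := exists_dyadic_finset (n + 1)
    classical
    refine ⟨D ∪ Z.filter fun x => wave w lam E (n + 1) x = 0, ?_, ?_, ?_⟩
    · have h1 := Finset.card_union_le D (Z.filter fun x => wave w lam E (n + 1) x = 0)
      -- At most 2^(n+1) zeros and 2^(n+1) - 1 dyadic points, so the card plus one is at most
      -- 2^(n+2).
      have h2 := Finset.card_filter_le Z fun x => wave w lam E (n + 1) x = 0
      rw [pow_succ 2 (n + 1)]
      omega
    · intro x hx hxS
      rw [Finset.mem_union, Finset.mem_filter, not_or] at hxS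
      have hni : NonInt (2 ^ (n + 1) * x) := by
        by_contra h
        exact hxS.1 (hD x hx h)
      refine ⟨hni, fun h0 => hxS.2 ⟨hZ x hx (fun hxS' => ?_) (by rw [h0]; simp), h0⟩⟩
      -- A zero of u_{n+1} missed by `Z` would be an old breakpoint: dyadic, hence already in `D`,
      -- or a zero of u_n, impossible since consecutive terms never vanish together.
      rcases hS' x hxS' with h | h
      · exact h hni.of_pow_succ
      · exact wave_ne_zero_of_succ_eq_zero w lam E h0 h
    · intro x hx
      rcases Finset.mem_union.1 hx with h | h
      · exact Or.inl (hD' x h)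
      · exact Or.inr (Finset.mem_filter.1 h).2

lemma ae_wave_ne_zero (hlam : 0 < lam) (hc : 0 < c)
    (hd : ∀ x, NonInt x → DifferentiableAt ℝ w x) (hσ : ∀ x, NonInt x → c ≤ -(σ * deriv w x))
    (n : ℕ) : ∀ᵐ x ∂(volume.restrict (Set.Ioo (0 : ℝ) 1)), wave w lam E n x ≠ 0 := by
  obtain ⟨S, -, hS, -⟩ := exists_breakpoints (E := E) hlam hc hd hσ n
  rw [ae_restrict_iff' measurableSet_Ioo]
  filter_upwards [S.finite_toSet.measure_zero volume |> compl_mem_ae_iff.2] with x hx hx1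
  exact (hS x hx1 hx).2

lemma volume_abs_ratio_lt_le (hlam : 0 < lam) (hc : 0 < c) (habs : |σ| = 1)
    (hd : ∀ x, NonInt x → DifferentiableAt ℝ w x) (hσ : ∀ x, NonInt x → c ≤ -(σ * deriv w x))
    (n : ℕ) (s : ℝ) (hs : 0 < s) :
    volume.restrict (Set.Ioo (0 : ℝ) 1)
      {x | |wave w lam E (n + 1) x / wave w lam E n x| < s} ≤
      ENNReal.ofReal (4 / (c * lam) * s) := by
  obtain ⟨S, hcard, hS, -⟩ := exists_breakpoints (E := E) hlam hc hd hσ n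
  have h := (wave_ratio_growsOffSet hlam hc.le hd hσ hS).volume_abs_lt_le (by positivity) s
  rw [Measure.restrict_apply' measurableSet_Ioo]
  refine (measure_mono ?_).trans (h.trans (ENNReal.ofReal_le_ofReal ?_))
  · intro x hx
    exact ⟨hx.2, by rw [abs_mul, habs, one_mul]; exact hx.1⟩
  · have hcard' : ((S.card : ℝ) + 1) ≤ 2 ^ (n + 1) := by exact_mod_cast hcard
    calc ((S.card : ℝ) + 1) * (2 * s / (c * lam * 2 ^ n))
        ≤ 2 ^ (n + 1) * (2 * s / (c * lam * 2 ^ n)) := by gcongr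
      _ = 4 / (c * lam) * s := by
        field_simp
        ring

/-- Each step of the recursion contributes at least `log (c lam / 4) - 1` to the mean of
`log |wave|`. -/
lemma integral_log_wave_ge (hlam : 0 < lam) (hc : 0 < c) (habs : |σ| = 1)
    (hd : ∀ x, NonInt x → DifferentiableAt ℝ w x) (hσ : ∀ x, NonInt x → c ≤ -(σ * deriv w x))
    (hmeas : ∀ n, Measurable (wave w lam E n)) {M : ℕ → ℝ}
    (hM : ∀ n x, Real.log |wave w lam E n x| ≤ M n) (n : ℕ) :
    IntegrableOn (fun x => Real.log |wave w lam E n x|) (Set.Ioo 0 1) ∧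
      n * (-1 - Real.log (4 / (c * lam))) ≤
        ∫ x in Set.Ioo (0 : ℝ) 1, Real.log |wave w lam E n x| := by
  set K : ℝ := 4 / (c * lam)
  have hK : 0 < K := by positivity
  have hlm : ∀ n, Measurable fun x => Real.log |wave w lam E n x| := fun n =>
    Real.measurable_log.comp (continuous_abs.measurable.comp (hmeas n))
  have hvol : (volume.restrict (Set.Ioo (0 : ℝ) 1)).real Set.univ = 1 := by
    simp [measureReal_def]
  induction n with
  | zero => simp [wave]
  | succ n ih =>
    obtain ⟨ih1, ih2⟩ := ih
    set g : ℝ → ℝ := fun x =>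
      max (-Real.log (K * |wave w lam E (n + 1) x / wave w lam E n x|)) 0
    have hrm : Measurable fun x => wave w lam E (n + 1) x / wave w lam E n x :=
      (hmeas (n + 1)).div (hmeas n)
    have hgm : Measurable g :=
      (Real.measurable_log.comp ((continuous_abs.measurable.comp hrm).const_mul K)).neg.max
        measurable_const
    have hg0 : ∀ x, 0 ≤ g x := fun x => le_max_right _ _
    have hgl : ∫⁻ x in Set.Ioo (0 : ℝ) 1, ENNReal.ofReal (g x) ≤ 1 :=
      lintegral_neg_log_le_one hrm.aemeasurable hK
        (volume_abs_ratio_lt_le hlam hc habs hd hσ n)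
    have hgi : IntegrableOn g (Set.Ioo 0 1) := by
      refine ⟨hgm.aestronglyMeasurable, ?_⟩
      rw [hasFiniteIntegral_iff_ofReal (.of_forall hg0)]
      exact hgl.trans_lt ENNReal.one_lt_top
    have hgint : ∫ x in Set.Ioo (0 : ℝ) 1, g x ≤ 1 := by
      rw [integral_eq_lintegral_of_nonneg_ae (.of_forall hg0) hgm.aestronglyMeasurable]
      exact ENNReal.toReal_le_of_le_ofReal zero_le_one (by simpa using hgl)
    have hlow : ∀ᵐ x ∂(volume.restrict (Set.Ioo (0 : ℝ) 1)),
        Real.log |wave w lam E n x| - g x - Real.log K ≤ Real.log |wave w lam E (n + 1) x| := by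
      filter_upwards [ae_wave_ne_zero (E := E) hlam hc hd hσ n,
        ae_wave_ne_zero (E := E) hlam hc hd hσ (n + 1)] with x h0 h1
      have : -Real.log (K * |wave w lam E (n + 1) x / wave w lam E n x|) ≤ g x := le_max_left _ _
      rw [abs_div, Real.log_mul hK.ne' (div_ne_zero (abs_ne_zero.2 h1) (abs_ne_zero.2 h0)),
        Real.log_div (abs_ne_zero.2 h1) (abs_ne_zero.2 h0)] at this
      linarith
    have hLi : IntegrableOn (fun x => Real.log |wave w lam E n x| - g x - Real.log K)
        (Set.Ioo 0 1) := (ih1.sub hgi).sub (integrable_const _)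
    -- The upper bound `M` serves only integrability; it does not enter the estimate.
    have hi : IntegrableOn (fun x => Real.log |wave w lam E (n + 1) x|) (Set.Ioo 0 1) :=
      integrable_of_le_of_le (hlm _).aestronglyMeasurable hlow
        (.of_forall fun x => hM (n + 1) x) hLi (integrable_const _)
    refine ⟨hi, ?_⟩
    have h1 := integral_mono_ae hLi hi hlow
    have h2 : ∫ x in Set.Ioo (0 : ℝ) 1, (Real.log |wave w lam E n x| - g x - Real.log K) =
        (∫ x in Set.Ioo (0 : ℝ) 1, (Real.log |wave w lam E n x| - g x)) -
          ∫ _ in Set.Ioo (0 : ℝ) 1, Real.log K := integral_sub (ih1.sub hgi) (integrable_const _)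
    rw [integral_sub ih1 hgi, integral_const, hvol, one_smul] at h2
    push_cast
    linarith

end Monotone

/-! ### Operator norms of 2 × 2 matrices -/

section OperatorNorm

open Matrix

local notation "opNorm" A => ‖Matrix.toEuclideanCLM (𝕜 := ℝ) A‖

lemma column_sq_le_opNorm_sq (A : Matrix (Fin 2) (Fin 2) ℝ) (j : Fin 2) :
    A 0 j ^ 2 + A 1 j ^ 2 ≤ (opNorm A) ^ 2 := by
  have h := (Matrix.toEuclideanCLM (𝕜 := ℝ) A).le_opNorm (EuclideanSpace.single j 1)
  have h2 := pow_le_pow_left₀ (norm_nonneg _) h 2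
  rw [EuclideanSpace.real_norm_sq_eq] at h2
  simpa [Fin.sum_univ_two] using h2

lemma abs_apply_le_opNorm (A : Matrix (Fin 2) (Fin 2) ℝ) : |A 0 0| ≤ opNorm A := by
  refine abs_le_of_sq_le_sq ?_ (norm_nonneg _)
  nlinarith [column_sq_le_opNorm_sq A 0, sq_nonneg (A 1 0)]

lemma one_le_opNorm_of_det_eq_one {A : Matrix (Fin 2) (Fin 2) ℝ} (h : A.det = 1) :
    1 ≤ opNorm A := by
  rw [Matrix.det_fin_two] at h
  have h0 := column_sq_le_opNorm_sq A 0
  have h1 := column_sq_le_opNorm_sq A 1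
  rw [← one_le_sq_iff₀ (norm_nonneg _)]
  -- The squared entries sum to at least 2 det A = 2 and at most twice the squared norm.
  nlinarith [sq_nonneg (A 0 0 - A 1 1), sq_nonneg (A 0 1 + A 1 0)]

lemma continuous_opNorm :
    Continuous fun A : Fin 2 → Fin 2 → ℝ => opNorm (Matrix.of A) :=
  (LinearMap.continuous_of_finiteDimensional
    (Matrix.toEuclideanCLM (n := Fin 2) (𝕜 := ℝ)).toAlgEquiv.toLinearMap).norm

end OperatorNorm

/-! ### The cocycle: integrability and existence of the limit -/

section Cocycle

variable (v : UnitAddCircle → ℝ) (lam E : ℝ)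

lemma doubling_iterate_coe (n : ℕ) (x : ℝ) :
    doubling^[n] (x : UnitAddCircle) = ((2 ^ n * x : ℝ) : UnitAddCircle) := by
  induction n with
  | zero => simp
  | succ n ih =>
    rw [Function.iterate_succ_apply', ih, doubling, ← AddCircle.coe_nsmul, nsmul_eq_mul]
    congr 1
    push_cast
    ring

lemma measurePreserving_doubling : MeasurePreserving doubling :=
  (AddCircle.ergodic_nsmul one_lt_two).toMeasurePreserving

lemma cocycleIter_apply_zero (n : ℕ) (x : ℝ) :
    cocycleIter v lam E n x 0 0 = wave (fun y : ℝ => v y) lam E n x := by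
  have hrow : ∀ n, cocycleIter v lam E (n + 1) x 1 0 = cocycleIter v lam E n x 0 0 := fun n => by
    simp [cocycleIter, cocycleMap, Matrix.mul_apply, Fin.sum_univ_two]
  induction n using Nat.twoStepInduction with
  | zero => simp [cocycleIter, wave]
  | one => simp [cocycleIter, cocycleMap, wave]
  | more n h0 h1 =>
    have : cocycleIter v lam E (n + 2) x 0 0 =
        (E - lam * v (doubling^[n + 1] x)) * cocycleIter v lam E (n + 1) x 0 0 -
          cocycleIter v lam E (n + 1) x 1 0 := by
      rw [cocycleIter, cocycleMap, Matrix.mul_apply, Fin.sum_univ_two]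
      simp [sub_eq_add_neg]
    rw [this, hrow, h0, h1, doubling_iterate_coe, wave]

lemma det_cocycleIter (n : ℕ) (x : UnitAddCircle) : (cocycleIter v lam E n x).det = 1 := by
  induction n with
  | zero => simp [cocycleIter]
  | succ n ih =>
    rw [cocycleIter, Matrix.det_mul, ih, mul_one]
    simp [cocycleMap, Matrix.det_fin_two]

lemma cocycleIter_add (m n : ℕ) (x : UnitAddCircle) :
    cocycleIter v lam E (m + n) x =
      cocycleIter v lam E m (doubling^[n] x) * cocycleIter v lam E n x := by
  induction m with
  | zero => simp [cocycleIter]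
  | succ m ih =>
    rw [Nat.succ_add, cocycleIter, ih, cocycleIter, Matrix.mul_assoc,
      Function.iterate_add_apply]

lemma logNorm_nonneg (n : ℕ) (x : UnitAddCircle) : 0 ≤ logNorm v lam E n x :=
  Real.log_nonneg (one_le_opNorm_of_det_eq_one (det_cocycleIter v lam E n x))

lemma logNorm_add_le (m n : ℕ) (x : UnitAddCircle) :
    logNorm v lam E (m + n) x ≤ logNorm v lam E m (doubling^[n] x) + logNorm v lam E n x := by
  have h1 := one_le_opNorm_of_det_eq_one (det_cocycleIter v lam E m (doubling^[n] x))
  have h2 := one_le_opNorm_of_det_eq_one (det_cocycleIter v lam E n x)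
  have h3 := one_le_opNorm_of_det_eq_one (det_cocycleIter v lam E (m + n) x)
  rw [logNorm, logNorm, logNorm, ← Real.log_mul (by positivity) (by positivity)]
  refine Real.log_le_log (by positivity) ?_
  rw [cocycleIter_add, map_mul]
  exact norm_mul_le _ _

lemma log_abs_wave_le_logNorm (n : ℕ) (x : ℝ) :
    Real.log |wave (fun y : ℝ => v y) lam E n x| ≤ logNorm v lam E n x := by
  rw [← cocycleIter_apply_zero v lam E n x]
  rcases eq_or_ne (cocycleIter v lam E n x 0 0) 0 with h | h
  -- Here `Real.log 0 = 0`, so nonnegativity of `logNorm` is what is needed.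
  · rw [h, abs_zero, Real.log_zero]
    exact logNorm_nonneg v lam E n x
  · exact Real.log_le_log (abs_pos.2 h) (abs_apply_le_opNorm _)

variable {v}

lemma measurable_cocycleIter (hv : Measurable v) (n : ℕ) (i j : Fin 2) :
    Measurable fun x => cocycleIter v lam E n x i j := by
  induction n generalizing i j with
  | zero => simp only [cocycleIter]; exact measurable_const
  | succ n ih =>
    have hT := hv.comp (measurePreserving_doubling.measurable.iterate n)
    simp only [cocycleIter, Matrix.mul_apply, Fin.sum_univ_two]
    refine (Measurable.mul ?_ (ih 0 j)).add (Measurable.mul ?_ (ih 1 j)) <;>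
      fin_cases i <;> simp only [cocycleMap] <;>
      first
      | exact measurable_const
      | exact measurable_const.sub (hT.const_mul lam)

lemma measurable_logNorm (hv : Measurable v) (n : ℕ) : Measurable (logNorm v lam E n) :=
  Real.measurable_log.comp (continuous_opNorm.measurable.comp
    (measurable_pi_lambda _ fun i => measurable_pi_lambda _ fun j =>
      measurable_cocycleIter lam E hv n i j))

lemma measurable_wave {w : ℝ → ℝ} (hw : Measurable w) (n : ℕ) :
    Measurable (wave w lam E n) := by
  induction n using Nat.twoStepInduction with
  | zero => exact measurable_const
  | one => exact measurable_const.sub (hw.const_mul lam)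
  | more n h0 h1 =>
    exact ((measurable_const.sub ((hw.comp (measurable_const_mul _)).const_mul lam)).mul h1).sub h0

lemma exists_logNorm_le {B : ℝ} (hB : ∀ x, |v x| ≤ B) :
    ∃ M, ∀ n x, logNorm v lam E n x ≤ n * M := by
  set N : Matrix (Fin 2) (Fin 2) ℝ → ℝ := fun A => ‖Matrix.toEuclideanCLM (𝕜 := ℝ) A‖ with hN
  set P : Matrix (Fin 2) (Fin 2) ℝ := !![1, 0; 0, 0]
  set J : Matrix (Fin 2) (Fin 2) ℝ := !![0, -1; 1, 0]
  have hbound : ∀ x, N (cocycleMap v lam E x) ≤ (|E| + |lam| * B) * N P + N J := by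
    intro x
    have hdec : cocycleMap v lam E x = (E - lam * v x) • P + J := by
      ext i j
      fin_cases i <;> fin_cases j <;> simp [cocycleMap, P, J]
    have h1 : |E - lam * v x| ≤ |E| + |lam| * B := by
      refine (abs_sub _ _).trans ?_
      rw [abs_mul]
      gcongr
      exact hB x
    rw [hdec]
    simp only [hN, map_add, map_smul]
    refine (norm_add_le _ _).trans ?_
    rw [norm_smul, Real.norm_eq_abs]
    gcongr
  refine ⟨Real.log ((|E| + |lam| * B) * N P + N J), fun n x => ?_⟩
  induction n with
  | zero => simp [logNorm, cocycleIter]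
  | succ n ih =>
    have h1 := logNorm_add_le v lam E 1 n x
    have hone : cocycleIter v lam E 1 (doubling^[n] x) = cocycleMap v lam E (doubling^[n] x) := by
      simp [cocycleIter]
    have hpos := one_le_opNorm_of_det_eq_one (det_cocycleIter v lam E 1 (doubling^[n] x))
    have h2 : logNorm v lam E 1 (doubling^[n] x) ≤
        Real.log ((|E| + |lam| * B) * N P + N J) := by
      refine Real.log_le_log (by positivity) ?_
      rw [hone]
      exact hbound _
    rw [add_comm 1 n] at h1
    push_cast
    linarith

lemma integrable_logNorm (hv : Measurable v) {B : ℝ} (hB : ∀ x, |v x| ≤ B) (n : ℕ) :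
    Integrable (logNorm v lam E n) := by
  obtain ⟨M, hM⟩ := exists_logNorm_le lam E hB
  refine (integrable_const ((n : ℝ) * M)).mono'
    (measurable_logNorm lam E hv n).aestronglyMeasurable (.of_forall fun x => ?_)
  rw [Real.norm_of_nonneg (logNorm_nonneg v lam E n x)]
  exact hM n x

lemma tendsto_meanLogNorm (hv : Measurable v) {B : ℝ} (hB : ∀ x, |v x| ≤ B) :
    Tendsto (fun n => meanLogNorm v lam E n) atTop (𝓝 (lyapunovExponent v E lam)) := by
  have hint := integrable_logNorm lam E hv hB
  have hsub : Subadditive fun n => ∫ x, logNorm v lam E n x := by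
    intro m n
    have hmp := measurePreserving_doubling.iterate n
    have hcomp : ∫ x, logNorm v lam E m (doubling^[n] x) = ∫ x, logNorm v lam E m x := by
      have h := integral_map (μ := volume) hmp.measurable.aemeasurable
        (measurable_logNorm lam E hv m).aestronglyMeasurable
      rw [hmp.map_eq] at h
      exact h.symm
    have hci : Integrable (logNorm v lam E m ∘ doubling^[n]) :=
      (hmp.integrable_comp (measurable_logNorm lam E hv m).aestronglyMeasurable).2 (hint m)
    calc ∫ x, logNorm v lam E (m + n) x
        ≤ ∫ x, (logNorm v lam E m (doubling^[n] x) + logNorm v lam E n x) :=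
          integral_mono (hint _) (hci.add (hint n)) (logNorm_add_le v lam E m n)
      _ = _ := (integral_add hci (hint n)).trans (congrArg (· + _) hcomp)
  have hbdd : BddBelow (Set.range fun n : ℕ => (∫ x, logNorm v lam E n x) / n) := by
    refine ⟨0, ?_⟩
    rintro _ ⟨n, rfl⟩
    exact div_nonneg (integral_nonneg (logNorm_nonneg v lam E n)) n.cast_nonneg
  -- Fekete's lemma.
  have hlim : Tendsto (fun n => meanLogNorm v lam E n) atTop (𝓝 hsub.lim) := by
    refine (hsub.tendsto_lim hbdd).congr fun n => ?_
    rw [meanLogNorm, one_div, div_eq_inv_mul]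
  rw [lyapunovExponent, hlim.limUnder_eq]
  exact hlim

end Cocycle

/-! ### Admissible potentials and the lower bound -/

section Admissible

variable {v : UnitAddCircle → ℝ}

lemma IsAdmissible.differentiableAt_Ioo (hv : IsAdmissible v) {x : ℝ}
    (hx : x ∈ Set.Ioo (0 : ℝ) 1) : DifferentiableAt ℝ (fun y : ℝ => v y) x :=
  (hv.contDiffOn.differentiableOn one_ne_zero).differentiableAt (isOpen_Ioo.mem_nhds hx)

lemma IsAdmissible.measurable (hv : IsAdmissible v) : Measurable v := by
  refine measurable_of_measurable_on_compl_singleton 0 ?_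
  refine Continuous.measurable (continuousOn_iff_continuous_domRestrict.1 fun z hz => ?_)
  obtain ⟨y, hy, rfl⟩ := AddCircle.eq_coe_Ico z
  have hy0 : y ≠ 0 := fun h => hz (by simp [h])
  have hc := (hv.differentiableAt_Ioo ⟨lt_of_le_of_ne hy.1 hy0.symm, hy.2⟩).continuousAt
  refine ContinuousAt.continuousWithinAt ?_
  change Tendsto v (𝓝 ((y : ℝ) : UnitAddCircle)) _
  have : 𝓝 ((y : ℝ) : UnitAddCircle) = Filter.map (fun t : ℝ => (t : UnitAddCircle)) (𝓝 y) :=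
    QuotientAddGroup.nhds_eq _ y
  rw [this, tendsto_map'_iff]
  exact hc

lemma IsAdmissible.exists_abs_le (hv : IsAdmissible v) : ∃ B, ∀ x, |v x| ≤ B := by
  obtain ⟨C, hC⟩ := hv.bounded
  refine ⟨max C |v 0|, fun z => ?_⟩
  obtain ⟨y, hy, rfl⟩ := AddCircle.eq_coe_Ico z
  rcases eq_or_lt_of_le hy.1 with h | h
  · rw [← h]
    exact le_max_right _ _
  · exact le_max_of_le_left ((le_add_of_nonneg_right (abs_nonneg _)).trans (hC y ⟨h, hy.2⟩))

/-- A continuous derivative bounded away from zero cannot change sign on an interval. -/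
lemma IsAdmissible.exists_sign (hv : IsAdmissible v) : ∃ c σ : ℝ, 0 < c ∧ |σ| = 1 ∧
    ∀ x ∈ Set.Ioo (0 : ℝ) 1, c ≤ -(σ * deriv (fun y : ℝ => v y) x) := by
  obtain ⟨c, hc, hbound⟩ := hv.deriv_bound
  have hcont := hv.contDiffOn.continuousOn_deriv_of_isOpen isOpen_Ioo le_rfl
  by_cases h : ∃ x ∈ Set.Ioo (0 : ℝ) 1, 0 < deriv (fun y : ℝ => v y) x
  · obtain ⟨x, hx, hpos⟩ := h
    refine ⟨c, -1, hc, by simp, fun y hy => ?_⟩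
    have hy0 : 0 < deriv (fun y : ℝ => v y) y := by
      by_contra! hneg
      obtain ⟨z, hz, hz0⟩ := isPreconnected_Ioo.intermediate_value hy hx hcont ⟨hneg, hpos.le⟩
      have := hbound z hz
      rw [hz0, abs_zero] at this
      linarith
    have := hbound y hy
    rw [abs_of_pos hy0] at this
    linarith
  · push Not at h
    refine ⟨c, 1, hc, by simp, fun y hy => ?_⟩
    have := hbound y hy
    rw [abs_of_nonpos (h y hy)] at this
    linarith

lemma IsAdmissible.hasDerivAt_of_nonInt (hv : IsAdmissible v) {x : ℝ} (hx : NonInt x) :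
    Int.fract x ∈ Set.Ioo (0 : ℝ) 1 ∧ HasDerivAt (fun y : ℝ => v y)
      (deriv (fun y : ℝ => v y) (Int.fract x)) x := by
  have hf : Int.fract x ∈ Set.Ioo (0 : ℝ) 1 := by
    refine ⟨lt_of_le_of_ne (Int.fract_nonneg x) fun h => hx ⌊x⌋ ?_, Int.fract_lt_one x⟩
    rw [← Int.self_sub_floor] at h
    linarith
  refine ⟨hf, ?_⟩
  have hper : (fun y : ℝ => v y) = fun y : ℝ => v ((y - ⌊x⌋ : ℝ) : UnitAddCircle) := by
    funext y
    have h0 : ((⌊x⌋ : ℝ) : UnitAddCircle) = 0 := (AddCircle.coe_eq_zero_iff 1).2 ⟨⌊x⌋, by simp⟩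
    rw [AddCircle.coe_sub, h0, sub_zero]
  have hd : HasDerivAt (fun y : ℝ => v y) (deriv (fun y : ℝ => v y) (Int.fract x)) (x - ⌊x⌋) :=
    (hv.differentiableAt_Ioo hf).hasDerivAt
  exact (hd.comp_sub_const x ⌊x⌋).congr_of_eventuallyEq (.of_eq hper)

lemma IsAdmissible.exists_log_sub_le (hv : IsAdmissible v) : ∃ C : ℝ, ∀ lam : ℝ, 0 < lam →
    ∀ E : ℝ, Real.log lam - C ≤ lyapunovExponent v E lam := by
  obtain ⟨c, σ, hc, habs, hsign⟩ := hv.exists_sign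
  obtain ⟨B, hB⟩ := hv.exists_abs_le
  have hd : ∀ x, NonInt x → DifferentiableAt ℝ (fun y : ℝ => v y) x := fun x hx =>
    (hv.hasDerivAt_of_nonInt hx).2.differentiableAt
  have hσ : ∀ x, NonInt x → c ≤ -(σ * deriv (fun y : ℝ => v y) x) := fun x hx => by
    obtain ⟨h1, h2⟩ := hv.hasDerivAt_of_nonInt hx
    rw [h2.deriv]
    exact hsign _ h1
  refine ⟨1 + Real.log 4 - Real.log c, fun lam hlam E => ?_⟩
  have hw : Measurable fun y : ℝ => v y := hv.measurable.comp AddCircle.measurable_mk'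
  obtain ⟨M, hM⟩ := exists_logNorm_le lam E hB
  refine ge_of_tendsto (tendsto_meanLogNorm lam E hv.measurable hB) ?_
  filter_upwards [eventually_gt_atTop 0] with n hn
  obtain ⟨h1, h2⟩ := integral_log_wave_ge (E := E) hlam hc habs hd hσ (measurable_wave lam E hw)
    (fun n x => (log_abs_wave_le_logNorm v lam E n x).trans (hM n x)) n
  have hint : IntegrableOn (fun x : ℝ => logNorm v lam E n x) (Set.Ioo 0 1) := by
    have := (UnitAddCircle.measurePreserving_mk 0).integrable_comp_of_integrable
      (integrable_logNorm lam E hv.measurable hB n)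
    rw [zero_add] at this
    exact IntegrableOn.mono_set this Set.Ioo_subset_Ioc_self
  have h3 : ∫ x in Set.Ioo (0 : ℝ) 1, logNorm v lam E n x = ∫ x, logNorm v lam E n x := by
    rw [← integral_Ioc_eq_integral_Ioo, ← UnitAddCircle.integral_preimage 0, zero_add]
  have h4 := integral_mono h1 hint (log_abs_wave_le_logNorm v lam E n)
  rw [h3] at h4
  have hn' : (0 : ℝ) < n := by exact_mod_cast hn
  rw [Real.log_div (by norm_num) (by positivity), Real.log_mul hc.ne' hlam.ne'] at h2
  rw [meanLogNorm, one_div, ← div_eq_inv_mul, le_div_iff₀ hn']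
  linarith

end Admissible

end DoublingMap

theorem theorem1 (v : UnitAddCircle → ℝ) (hv : DoublingMap.IsAdmissible v) :
    -- the Lyapunov exponent is well defined, for every coupling and every energy
    (∀ lam : ℝ, 0 < lam → ∀ E : ℝ,
      (∀ n : ℕ, Integrable (DoublingMap.logNorm v lam E n) volume) ∧
      Tendsto (fun n : ℕ => DoublingMap.meanLogNorm v lam E n) atTop
        (𝓝 (DoublingMap.lyapunovExponent v E lam))) ∧
    -- the lower bound
    (∃ C₀ : ℝ, 0 < C₀ ∧ ∀ lam : ℝ, 0 < lam → ∀ E : ℝ,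
      Real.log lam - C₀ < DoublingMap.lyapunovExponent v E lam) ∧
    -- uniform positivity in the energy at large coupling
    (∃ lam₀ : ℝ, 1 < lam₀ ∧ ∃ c : ℝ, 0 < c ∧ ∀ lam : ℝ, lam₀ ≤ lam → ∀ E : ℝ,
      c * Real.log lam ≤ DoublingMap.lyapunovExponent v E lam) := by
  obtain ⟨B, hB⟩ := hv.exists_abs_le
  obtain ⟨C, hC⟩ := hv.exists_log_sub_le
  refine ⟨fun lam _ E => ⟨DoublingMap.integrable_logNorm lam E hv.measurable hB,
    DoublingMap.tendsto_meanLogNorm lam E hv.measurable hB⟩,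
    ⟨|C| + 1, by positivity, fun lam hlam E => ?_⟩,
    -- This threshold forces log λ ≥ 2|C|, so subtracting C leaves at least half of log λ.
    ⟨Real.exp (2 * |C| + 1), Real.one_lt_exp_iff.2 (by positivity), 1 / 2, by norm_num,
      fun lam hlam E => ?_⟩⟩
  · have := hC lam hlam E
    have := le_abs_self C
    linarith
  · have hpos : 0 < lam := (Real.exp_pos _).trans_le hlam
    have h1 := (Real.le_log_iff_exp_le hpos).2 hlam
    have := hC lam hpos E
    have := le_abs_self C
    linarith
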